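/- Let $P\subset\mathbb R^n$ be a rational polytope (the convex hull of finitely many points of $\mathbb Q^n$) with $\dim P\ge 1$, and let $v\in P$ be an arbitrary point. Then $P$ has only finitely many facets and $$\operatorname{Vol} P=\sum_{F\text{ facet of }P}\operatorname{Ht}_F(v)\,\operatorname{Vol}F .$$ Here facets are the nonempty faces of dimension $\dim P-1$, a face being the set of points of $P$ at which some linear form attains its maximum on $P$. For a rational polytope $Q$ with affine hull $A$, let $A_0=A-w$ ($w\in A$) be the parallel linear subspace, and let $u_1,\dots,u_d$ be a $\mathbb Z$-basis of $A_0\cap\mathbb Z^n$, $d=\dim Q$. Then $\operatorname{Vol}Q$, the lattice normalized volume, is the measure of $Q-w$ with respect to the Lebesgue measure on $A_0$, scaled such that the simplex $\operatorname{conv}(0,u_1,\dots,u_d)$ has measure $1$. For a facet $F$ of $P$ let $H$ be its affine hull. If $v\in H$, then $\operatorname{Ht}_F(v)=0$. Otherwise let $A$ be the affine hull of $H\cup\{v\}$, choose $p\in H$, and let $\lambda$ be a linear form on $A-p$ that is integral and primitive on the lattice $(A-p)\cap\mathbb Z^n$ and satisfies $H-p=\{y\in A-p:\lambda(y)=0\}$;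 then $\operatorname{Ht}_F(v)=|\lambda(v-p)|$, the lattice height of $v$ over $F$. These quantities do not depend on the choices made. -/

import Mathlib

open MeasureTheory

noncomputable section

namespace LatticeGeometry

/-- `ℝⁿ` with its Euclidean structure. -/
abbrev E (n : ℕ) : Type := EuclideanSpace ℝ (Fin n)

/-- The inclusion `ℤⁿ → ℝⁿ`. -/
def intEmb (n : ℕ) : (Fin n → ℤ) →ₗ[ℤ] E n where
  toFun z := WithLp.toLp 2 (fun i => (z i : ℝ))
  map_add' x y := by ext i; simp
  map_smul' c x := by ext i; simp

/-- A point of `ℝⁿ` with rational coordinates. -/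
def IsRationalPoint {n : ℕ} (x : E n) : Prop := ∀ i, ∃ q : ℚ, x i = (q : ℝ)

/-- A rational polytope: the convex hull of finitely many rational points. -/
def IsRationalPolytope {n : ℕ} (P : Set (E n)) : Prop :=
  ∃ s : Finset (E n), (∀ x ∈ s, IsRationalPoint x) ∧ P = convexHull ℝ (s : Set (E n))

/-- The dimension of a subset of `ℝⁿ`: the dimension of its affine hull
(the empty set gets the value `0`). -/
def dim {n : ℕ} (X : Set (E n)) : ℕ := Module.finrank ℝ (affineSpan ℝ X).direction

/-- `F` is a facet of `P`: a nonempty face (the set of points of `P` at which some linear form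
attains its maximum on `P`) of dimension `dim P - 1`. -/
def IsFacet {n : ℕ} (P F : Set (E n)) : Prop :=
  F.Nonempty ∧ IsExposed ℝ P F ∧ dim F + 1 = dim P

/-- The lattice `A₀ ∩ ℤⁿ`, where `A₀` is the linear subspace parallel to `A`. -/
def lattice {n : ℕ} (A : AffineSubspace ℝ (E n)) : Submodule ℤ (Fin n → ℤ) :=
  (A.direction.restrictScalars ℤ).comap (intEmb n)

/-- The simplex `conv(0, v₁, …, v_d)` for a `ℤ`-basis `v₁, …, v_d` of `A₀ ∩ ℤⁿ`. -/
def unimodularSimplex {n : ℕ} (A : AffineSubspace ℝ (E n)) : Set (E n) :=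
  convexHull ℝ (insert 0 (Set.range fun j => intEmb n (Module.finBasis ℤ (lattice A) j)))

open Classical in
/-- The lattice normalized volume on a rational affine subspace `A`, evaluated at `X ⊆ A`:
Lebesgue measure on `A₀ = A - w`, `w ∈ A`, scaled such that `conv(0, v₁, …, v_d)` has
measure `1`, and evaluated at `X - w`. -/
def volOn {n : ℕ} (A : AffineSubspace ℝ (E n)) (X : Set (E n)) : ℝ :=
  if h : (A : Set (E n)).Nonempty then
    (volume : Measure A.direction).real {u | (u : E n) + h.some ∈ X} /
      (volume : Measure A.direction).real {u | (u : E n) ∈ unimodularSimplex A}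
  else 0

/-- The lattice normalized volume of a rational polytope. -/
def Vol {n : ℕ} (P : Set (E n)) : ℝ := volOn (affineSpan ℝ P) P

/-- The linear form `l` (of which only the restriction to `A₀` matters) is integral and primitive
on the lattice `A₀ ∩ ℤⁿ`: it has integral values there, and is not an integral multiple `k • l'`
of such a form unless `k = ± 1`. -/
def IsPrimitiveOn {n : ℕ} (A : AffineSubspace ℝ (E n)) (l : E n →ₗ[ℝ] ℝ) : Prop :=
  (∀ z ∈ lattice A, ∃ m : ℤ, l (intEmb n z) = m) ∧
    ∀ k : ℤ, (∀ z ∈ lattice A, ∃ m : ℤ, l (intEmb n z) = k * m) → IsUnit k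

/-- `t = |l (x - p)|` for some `p ∈ H` and some primitive form `l` on `A₀ ∩ ℤⁿ` that cuts out
`H - p` from `A₀ = A - p`, where `A` is the affine hull of `H` and `x`. -/
def IsHeight {n : ℕ} (H : AffineSubspace ℝ (E n)) (x : E n) (t : ℝ) : Prop :=
  ∃ p ∈ H, ∃ l : E n →ₗ[ℝ] ℝ,
    IsPrimitiveOn (affineSpan ℝ (insert x (H : Set (E n)))) l ∧
    H.direction = (affineSpan ℝ (insert x (H : Set (E n)))).direction ⊓ LinearMap.ker l ∧
    t = |l (x - p)|

open Classical in
/-- The lattice height of `x` over `H`. -/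
def htOver {n : ℕ} (H : AffineSubspace ℝ (E n)) (x : E n) : ℝ :=
  if x ∈ H then 0 else if h : ∃ t, IsHeight H x t then h.choose else 0

/-- The lattice height of `x` over the affine hull of `F`. -/
def Ht {n : ℕ} (F : Set (E n)) (x : E n) : ℝ := htOver (affineSpan ℝ F) x

end LatticeGeometry

end

/-! Joining `v` to the facets whose affine hull misses `v` cuts `P` into pyramids. A ray from `v`
through another point of `P` leaves `P` at a point of a proper exposed face; unless that face
together with `v` spans too small a subspace, it is a facet. The exceptional points lie in finitely
many proper affine subspaces, a null set. Two such pyramids meet only in the affine hull of `v` and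
the intersection of their bases, again a null set (`volOn_eq_sum_pyramids`). Facets whose affine
hull contains `v` have height 0 and contribute nothing.

For one pyramid (`volOn_pyramid`), Lebesgue measure is a constant times height times measure of the
base, the constant depending only on the two subspaces and the transversal vector `w`. If `w`
completes a lattice basis of `H` to one of `A`, the unimodular simplex of `A` is itself a pyramid of
height 1 over that of `H`. The same constant appears, so it cancels in the normalized volumes. -/

noncomputable section

namespace LatticeGeometry

variable {n : ℕ}

open scoped ENNReal Pointwise

/-! ### Rational subspaces and their lattices -/

/-- An affine subspace is rational if its direction is spanned by integral vectors. -/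
def IsRationalSubspace (A : AffineSubspace ℝ (E n)) : Prop :=
  Submodule.span ℝ (intEmb n '' (lattice A : Set (Fin n → ℤ))) = A.direction

theorem intEmb_apply (z : Fin n → ℤ) (i : Fin n) : intEmb n z i = (z i : ℝ) := rfl

theorem mem_lattice {A : AffineSubspace ℝ (E n)} {z : Fin n → ℤ} :
    z ∈ lattice A ↔ intEmb n z ∈ A.direction := Iff.rfl

theorem linearIndependent_intEmb {ι : Type*} {b : ι → Fin n → ℤ} (hb : LinearIndependent ℤ b) :
    LinearIndependent ℝ (fun j => intEmb n (b j)) := by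
  have h := (linearIndependent_algebraMap_comp_iff (R := ℤ) (S := ℝ)).2 hb
  have h2 := h.map' (WithLp.linearEquiv 2 ℝ (Fin n → ℝ)).symm.toLinearMap (LinearEquiv.ker _)
  exact h2

/-- Clearing denominators turns every rational spanning vector into an integral one on the same
line. -/
theorem isRationalSubspace_of_span {A : AffineSubspace ℝ (E n)} {S : Set (E n)}
    (hS : A.direction = Submodule.span ℝ S)
    (h : ∀ x ∈ S, IsRationalPoint x) : IsRationalSubspace A := by
  apply le_antisymm
  · rw [Submodule.span_le]
    rintro _ ⟨z, hz, rfl⟩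
    exact hz
  · have key : ∀ x ∈ S, ∃ k : ℤ, k ≠ 0 ∧ ∃ z : Fin n → ℤ, intEmb n z = (k : ℝ) • x := by
      intro x hx
      choose q hq using h x hx
      refine ⟨∏ i, ((q i).den : ℤ), Finset.prod_ne_zero_iff.2 fun i _ => by
        exact_mod_cast (q i).den_ne_zero, fun i => (q i).num * ∏ j ∈ Finset.univ.erase i, ((q j).den : ℤ), ?_⟩
      ext i
      rw [intEmb_apply, ← Finset.mul_prod_erase Finset.univ _ (Finset.mem_univ i)]
      have hd : ((q i).den : ℝ) ≠ 0 := by exact_mod_cast (q i).den_ne_zero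
      have : (q i : ℝ) = (q i).num / (q i).den := by exact_mod_cast (Rat.num_div_den (q i)).symm
      simp only [PiLp.smul_apply, smul_eq_mul, hq i]
      rw [this]
      push_cast
      field_simp
    rw [hS, Submodule.span_le]
    intro x hx
    obtain ⟨k, hk, z, hz⟩ := key x hx
    have hk' : (k : ℝ) ≠ 0 := by exact_mod_cast hk
    have hxz : x = (k : ℝ)⁻¹ • intEmb n z := by rw [hz, inv_smul_smul₀ hk']
    have hmem : z ∈ lattice A := by
      rw [mem_lattice, hz, hS]
      exact Submodule.smul_mem _ _ (Submodule.subset_span hx)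
    rw [hxz]
    exact Submodule.smul_mem _ _ (Submodule.subset_span ⟨z, hmem, rfl⟩)

theorem IsRationalPolytope.isRationalSubspace {P : Set (E n)} (hP : IsRationalPolytope P) :
    IsRationalSubspace (affineSpan ℝ P) := by
  obtain ⟨s, hs, rfl⟩ := hP
  rw [affineSpan_convexHull]
  rcases s.eq_empty_or_nonempty with rfl | ⟨p, hp⟩
  · refine isRationalSubspace_of_span (S := ∅) (by simp) (by simp)
  · refine isRationalSubspace_of_span (S := (fun x => x -ᵥ p) '' (s : Set (E n))) ?_ ?_
    · rw [direction_affineSpan, vectorSpan_eq_span_vsub_set_right ℝ (Finset.mem_coe.2 hp)]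
    · rintro _ ⟨x, hx, rfl⟩ i
      obtain ⟨a, ha⟩ := hs x hx i
      obtain ⟨b, hb⟩ := hs p hp i
      exact ⟨a - b, by simp [ha, hb]⟩

/-- A `ℤ`-basis of the lattice of a rational subspace is an `ℝ`-basis of its direction. -/
def realBasis {A : AffineSubspace ℝ (E n)} (hA : IsRationalSubspace A) {ι : Type*}
    (b : Module.Basis ι ℤ (lattice A)) : Module.Basis ι ℝ A.direction :=
  Module.Basis.mk (v := fun j => (⟨intEmb n (b j), (b j).2⟩ : A.direction))
    (by
      have h : LinearIndependent ℤ (fun j => ((b j : lattice A) : Fin n → ℤ)) :=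
        b.linearIndependent.map' (lattice A).subtype (Submodule.ker_subtype _)
      exact LinearIndependent.of_comp A.direction.subtype (linearIndependent_intEmb h))
    (by
      have key : ∀ z : lattice A, (⟨intEmb n z, z.2⟩ : A.direction) ∈
          Submodule.span ℝ (Set.range fun j => (⟨intEmb n (b j), (b j).2⟩ : A.direction)) := by
        intro z
        induction b.mem_span z using Submodule.span_induction with
        | mem x hx =>
          obtain ⟨j, rfl⟩ := hx
          exact Submodule.subset_span ⟨j, rfl⟩
        | zero => convert Submodule.zero_mem _ using 1; ext; simp
        | add x y _ _ hx hy => convert Submodule.add_mem _ hx hy using 1; ext; simp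
        | smul a x _ hx =>
          convert Submodule.smul_mem _ (a : ℝ) hx using 1
          ext i
          simp [intEmb_apply]
      rintro ⟨x, hx⟩ -
      have hx' := hx
      rw [← hA] at hx'
      have h2 : Submodule.span ℝ (intEmb n '' (lattice A : Set (Fin n → ℤ))) ≤
          (Submodule.span ℝ (Set.range fun j =>
            (⟨intEmb n (b j), (b j).2⟩ : A.direction))).map A.direction.subtype := by
        rw [Submodule.span_le]
        rintro _ ⟨z, hz, rfl⟩
        exact ⟨_, key ⟨z, hz⟩, rfl⟩
      obtain ⟨y, hy, hyx⟩ := h2 hx'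
      have : y = ⟨x, hx⟩ := Subtype.ext hyx
      rwa [← this])

theorem realBasis_apply {A : AffineSubspace ℝ (E n)} (hA : IsRationalSubspace A) {ι : Type*}
    (b : Module.Basis ι ℤ (lattice A)) (j : ι) :
    (realBasis hA b j : E n) = intEmb n (b j) := by
  simp [realBasis]

theorem IsRationalSubspace.finrank_lattice {A : AffineSubspace ℝ (E n)}
    (hA : IsRationalSubspace A) :
    Module.finrank ℤ (lattice A) = Module.finrank ℝ A.direction := by
  rw [Module.finrank_eq_card_basis (realBasis hA (Module.finBasis ℤ (lattice A)))]
  simp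

theorem lattice_mono {A B : AffineSubspace ℝ (E n)} (h : A.direction ≤ B.direction) :
    lattice A ≤ lattice B := fun _ hz => h hz

/-- A vector `w` completing the lattice of a rational hyperplane `H` of `A` to that of `A`. -/
theorem exists_complement {A H : AffineSubspace ℝ (E n)} (hA : IsRationalSubspace A)
    (hH : IsRationalSubspace H) (hle : H.direction ≤ A.direction)
    (hd : Module.finrank ℝ H.direction + 1 = Module.finrank ℝ A.direction) :
    ∃ w ∈ lattice A, intEmb n w ∉ H.direction ∧
      ∀ z ∈ lattice A, ∃ c : ℤ, z + c • w ∈ lattice H := by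
  set N := (lattice H).comap (lattice A).subtype with hN
  -- The lattice of `H` is saturated, being cut out by a real subspace; the quotient is therefore
  -- free, of rank 1, and `w` lifts a generator.
  have tf : Module.IsTorsionFree ℤ (lattice A ⧸ N) := by
    refine Module.isTorsionFree_iff_smul_eq_zero.2 ?_
    intro k q hq
    obtain ⟨z, rfl⟩ := Submodule.Quotient.mk_surjective N q
    rw [← Submodule.Quotient.mk_smul, Submodule.Quotient.mk_eq_zero] at hq
    by_cases hk : k = 0
    · exact Or.inl hk
    · right
      rw [Submodule.Quotient.mk_eq_zero]
      have h1 : intEmb n (k • (z : Fin n → ℤ)) ∈ H.direction := hq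
      have h2 : intEmb n (k • (z : Fin n → ℤ)) = (k : ℝ) • intEmb n z := by
        rw [map_smul]; exact (Int.cast_smul_eq_zsmul ℝ k _).symm
      rw [h2] at h1
      have hk' : (k : ℝ) ≠ 0 := by exact_mod_cast hk
      exact (Submodule.smul_mem_iff H.direction hk').1 h1
  have hfr : Module.finrank ℤ (lattice A ⧸ N) = 1 := by
    have h1 := N.finrank_quotient_add_finrank
    have h2 : Module.finrank ℤ N = Module.finrank ℤ (lattice H) :=
      (Submodule.comapSubtypeEquivOfLe (lattice_mono hle)).finrank_eq
    rw [h2, hH.finrank_lattice, hA.finrank_lattice] at h1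
    omega
  let b := Module.finBasisOfFinrankEq ℤ (lattice A ⧸ N) hfr
  obtain ⟨w, hw⟩ := Submodule.Quotient.mk_surjective N (b 0)
  refine ⟨w, w.2, ?_, ?_⟩
  · intro h
    have : (w : lattice A) ∈ N := h
    rw [← Submodule.Quotient.mk_eq_zero, hw] at this
    exact b.ne_zero 0 this
  · intro z hz
    have h := b.sum_repr (Submodule.Quotient.mk ⟨z, hz⟩)
    rw [Fin.sum_univ_one, ← hw, ← Submodule.Quotient.mk_smul, Submodule.Quotient.eq] at h
    refine ⟨-(b.repr (Submodule.Quotient.mk ⟨z, hz⟩) 0), ?_⟩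
    have h3 := N.neg_mem h
    have : ((-((b.repr (Submodule.Quotient.mk ⟨z, hz⟩) 0) • w - ⟨z, hz⟩) : lattice A) :
        Fin n → ℤ) ∈ lattice H := h3
    convert this using 1
    simp [sub_eq_add_neg, add_comm]

/-! ### Lebesgue measure of pyramids -/

theorem mem_convexJoin_singleton {V : Type*} [AddCommGroup V] [Module ℝ V] {a x : V} {K : Set V} :
    x ∈ convexJoin ℝ {a} K ↔ ∃ r ∈ Set.Icc (0 : ℝ) 1, ∃ k ∈ K, x = r • a + (1 - r) • k := by
  simp only [mem_convexJoin, Set.mem_singleton_iff, exists_eq_left, segment, Set.mem_ofPred_eq]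
  constructor
  · rintro ⟨k, hk, r, t, hr, ht, hrt, rfl⟩
    exact ⟨r, ⟨hr, by linarith⟩, k, hk, by rw [← hrt]; simp⟩
  · rintro ⟨r, hr, k, hk, rfl⟩
    exact ⟨k, hk, r, 1 - r, hr.1, by linarith [hr.2], by ring, rfl⟩

theorem isCompact_convexJoin_singleton {V : Type*} [NormedAddCommGroup V] [NormedSpace ℝ V] (a : V)
    {K : Set V} (hK : IsCompact K) : IsCompact (convexJoin ℝ {a} K) := by
  have : convexJoin ℝ {a} K =
      (fun p : ℝ × V => p.1 • a + (1 - p.1) • p.2) '' (Set.Icc (0 : ℝ) 1 ×ˢ K) := by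
    ext x
    rw [mem_convexJoin_singleton]
    constructor
    · rintro ⟨r, hr, k, hk, rfl⟩
      exact ⟨(r, k), ⟨hr, hk⟩, rfl⟩
    · rintro ⟨⟨r, k⟩, ⟨hr, hk⟩, rfl⟩
      exact ⟨r, hr, k, hk, rfl⟩
  rw [this]
  exact (isCompact_Icc.prod hK).image (by fun_prop)

/-- The measure of a slice of a pyramid over a base of dimension `d` and measure `1`. -/
def slice (d : ℕ) : ℝ → ℝ≥0∞ :=
  (Set.Icc (0 : ℝ) 1).indicator fun r => ENNReal.ofReal |(1 - r) ^ d|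

theorem measurable_slice (d : ℕ) : Measurable (slice d) :=
  Measurable.indicator (by fun_prop) measurableSet_Icc

/-- The exact value of the integral is irrelevant because it cancels in normalized volumes; only
that it is nonzero and finite matters. -/
theorem lintegral_slice_ne_zero (d : ℕ) : ∫⁻ r, slice d r ≠ 0 := by
  rw [← pos_iff_ne_zero, lintegral_pos_iff_support (measurable_slice d)]
  have : Set.Ioo (0 : ℝ) 1 ⊆ Function.support (slice d) := by
    intro r hr
    rw [Function.mem_support, slice, Set.indicator_of_mem (Set.Ioo_subset_Icc_self hr)]
    have : 0 < 1 - r := by linarith [hr.2]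
    simp only [ne_eq, ENNReal.ofReal_eq_zero, not_le]
    positivity
  refine lt_of_lt_of_le ?_ (measure_mono this)
  simp

theorem lintegral_slice_ne_top (d : ℕ) : ∫⁻ r, slice d r ≠ ∞ := by
  have : ∫⁻ r, slice d r ≤ ∫⁻ r, (Set.Icc (0 : ℝ) 1).indicator (fun _ => (1 : ℝ≥0∞)) r := by
    refine lintegral_mono fun r => Set.indicator_le_indicator' fun hr => ?_
    rw [← ENNReal.ofReal_one]
    apply ENNReal.ofReal_le_ofReal
    rw [abs_pow]
    exact pow_le_one₀ (abs_nonneg _) (abs_le.2 ⟨by linarith [hr.2], by linarith [hr.1]⟩)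
  refine ne_top_of_le_ne_top ?_ this
  rw [lintegral_indicator_const measurableSet_Icc]
  simp

theorem lintegral_slice_div (d : ℕ) {h : ℝ} (hh : h ≠ 0) :
    ∫⁻ s, slice d (h⁻¹ * s) = ENNReal.ofReal |h| * ∫⁻ r, slice d r := by
  rw [← lintegral_map (measurable_slice d) (measurable_const_mul h⁻¹),
    Real.map_volume_mul_left (inv_ne_zero hh), inv_inv, lintegral_smul_measure, smul_eq_mul]

/-- The measure of a pyramid in terms of its base and the position of its apex. -/
theorem exists_volume_pyramid {H V : Submodule ℝ (E n)} (hle : H ≤ V)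
    (hd : Module.finrank ℝ H + 1 = Module.finrank ℝ V) {w : E n} (hw : w ∈ V) (hwH : w ∉ H) :
    ∃ c : ℝ≥0∞, c ≠ 0 ∧ c ≠ ∞ ∧ ∀ K : Set (E n), K ⊆ H → IsCompact K → ∀ h : ℝ, h ≠ 0 →
      ∀ y ∈ H, (volume : Measure V) {u | (u : E n) ∈ convexJoin ℝ {h • w + y} K} =
        c * ENNReal.ofReal |h| * (volume : Measure H) {u | (u : E n) ∈ K} := by
  let f : (H × ℝ) →ₗ[ℝ] V := (Submodule.inclusion hle).coprod (LinearMap.toSpanSingleton ℝ V ⟨w, hw⟩)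
  have hf : ∀ y s, (f (y, s) : E n) = y + s • w := fun y s => by simp [f]
  have uniq : ∀ (y : H) (s : ℝ), (y : E n) + s • w = 0 → y = 0 ∧ s = 0 := by
    intro y s h
    have hs : s = 0 := by
      by_contra hs
      apply hwH
      have : s • w = -(y : E n) := by rw [eq_neg_iff_add_eq_zero, add_comm, h]
      exact (Submodule.smul_mem_iff _ hs).1 (this ▸ H.neg_mem y.2)
    subst hs
    exact ⟨by simpa using h, rfl⟩
  have hinj : Function.Injective f := by
    rw [← LinearMap.ker_eq_bot, Submodule.eq_bot_iff]
    rintro ⟨y, s⟩ h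
    have h0 := hf y s
    rw [LinearMap.mem_ker.1 h] at h0
    obtain ⟨h1, h2⟩ := uniq y s (by simpa using h0.symm)
    rw [h1, h2]; rfl
  have hfin : Module.finrank ℝ (H × ℝ) = Module.finrank ℝ V := by
    rw [Module.finrank_prod, Module.finrank_self, hd]
  let Φ : (H × ℝ) ≃L[ℝ] V := (f.linearEquivOfInjective hinj hfin).toContinuousLinearEquiv
  have hΦ : ∀ y s, (Φ (y, s) : E n) = y + s • w := hf
  have hmeas := Φ.symm.toHomeomorph.measurableEmbedding
  have : (Measure.map Φ.symm (volume : Measure V)).IsAddHaarMeasure :=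
    Φ.symm.isAddHaarMeasure_map _
  set ν : Measure (H × ℝ) := (volume : Measure H).prod (volume : Measure ℝ) with hν
  -- By uniqueness of Haar measure, volume on `V` is a constant multiple of the product measure in
  -- the coordinates `(y, s) ↦ y + s • w`.
  have hmap := Measure.isAddLeftInvariant_eq_smul (Measure.map Φ.symm (volume : Measure V)) ν
  set c₀ := Measure.addHaarScalarFactor (Measure.map Φ.symm (volume : Measure V)) ν
  have hc₀ : 0 < c₀ := Measure.addHaarScalarFactor_pos_of_isAddHaarMeasure _ _
  set d := Module.finrank ℝ H
  refine ⟨c₀ * ∫⁻ r, slice d r, mul_ne_zero (by exact_mod_cast hc₀.ne') (lintegral_slice_ne_zero d),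
    ENNReal.mul_ne_top ENNReal.coe_ne_top (lintegral_slice_ne_top d), ?_⟩
  intro K hK hKc h hh y₀ hy₀
  set X : Set V := {u | (u : E n) ∈ convexJoin ℝ {h • w + y₀} K} with hX
  set B : Set H := {u | (u : E n) ∈ K} with hB
  have hXm : MeasurableSet X :=
    ((isCompact_convexJoin_singleton _ hKc).isClosed.preimage continuous_subtype_val).measurableSet
  have e1 : (volume : Measure V) X = c₀ * ν (Φ ⁻¹' X) := by
    have h1 : Measure.map Φ.symm (volume : Measure V) (Φ ⁻¹' X) = volume X := by
      have := hmeas.map_apply (volume : Measure V) (Φ ⁻¹' X)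
      refine this.trans ?_
      congr 1
      ext u
      simp
    rw [← h1, hmap]
    rfl
  -- At level `s = r * h` the slice is a translate of the base scaled by `1 - r`; it is empty unless
  -- `r` lies in `[0, 1]`.
  have hfib : ∀ s : ℝ, (volume : Measure H) ((fun y => (y, s)) ⁻¹' (Φ ⁻¹' X)) =
      slice d (h⁻¹ * s) * volume B := by
    intro s
    have hiff : ∀ y : H, (y, s) ∈ Φ ⁻¹' X ↔ h⁻¹ * s ∈ Set.Icc (0 : ℝ) 1 ∧
        ∃ k ∈ B, y = (h⁻¹ * s) • (⟨y₀, hy₀⟩ : H) + (1 - h⁻¹ * s) • k := by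
      intro y
      rw [Set.mem_preimage, hX, Set.mem_ofPred_eq, hΦ, mem_convexJoin_singleton]
      constructor
      · rintro ⟨r, hr, k, hk, e⟩
        obtain ⟨h1, h2⟩ := uniq (y - r • ⟨y₀, hy₀⟩ - (1 - r) • ⟨k, hK hk⟩) (s - r * h) (by
          simp only [Submodule.coe_sub, Submodule.coe_smul]
          linear_combination (norm := module) e)
        have hrs : h⁻¹ * s = r := by field_simp; linarith
        rw [hrs]
        refine ⟨hr, ⟨k, hK hk⟩, hk, ?_⟩
        linear_combination (norm := module) h1
      · rintro ⟨hr, k, hk, rfl⟩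
        refine ⟨_, hr, k, hk, ?_⟩
        have : s • w = ((h⁻¹ * s) * h) • w := by congr 1; field_simp
        simp only [Submodule.coe_add, Submodule.coe_smul]
        rw [this]
        module
    by_cases hs : h⁻¹ * s ∈ Set.Icc (0 : ℝ) 1
    · have : (fun y => (y, s)) ⁻¹' (Φ ⁻¹' X) =
          ((h⁻¹ * s) • (⟨y₀, hy₀⟩ : H)) +ᵥ ((1 - h⁻¹ * s) • B) := by
        ext y
        rw [Set.mem_preimage, hiff]
        simp only [hs, true_and, Set.mem_vadd_set, Set.mem_smul_set, exists_exists_and_eq_and,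
          vadd_eq_add]
        exact exists_congr fun k => and_congr_right fun _ => eq_comm
      rw [this, measure_vadd, Measure.addHaar_smul, slice, Set.indicator_of_mem hs]
    · have : (fun y => (y, s)) ⁻¹' (Φ ⁻¹' X) = ∅ := by
        ext y
        rw [Set.mem_preimage, hiff]
        simp [hs]
      rw [this, slice, Set.indicator_of_notMem hs]
      simp
  rw [e1, hν, Measure.prod_apply_symm (Φ.continuous.measurable hXm)]
  simp_rw [hfib]
  rw [lintegral_mul_const _ (by exact (measurable_slice d).comp (measurable_const_mul _)),
    lintegral_slice_div d hh]
  ring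

/-! ### Normalized volume and lattice height of a pyramid -/

/-- A linear automorphism carrying one basis of a lattice to another preserves volume, hence the
volume of the unimodular simplex does not depend on the basis. -/
theorem volume_simplex_eq {A : AffineSubspace ℝ (E n)} (hA : IsRationalSubspace A)
    {ι κ : Type*} [Finite ι] [Finite κ]
    (b : Module.Basis ι ℤ (lattice A)) (b' : Module.Basis κ ℤ (lattice A)) :
    (volume : Measure A.direction)
        {u | (u : E n) ∈ convexHull ℝ (insert 0 (Set.range fun j => intEmb n (b j)))} =
      (volume : Measure A.direction)
        {u | (u : E n) ∈ convexHull ℝ (insert 0 (Set.range fun j => intEmb n (b' j)))} := by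
  classical
  cases nonempty_fintype ι
  cases nonempty_fintype κ
  let e : ι ≃ κ := b.indexEquiv b'
  let c : Module.Basis ι ℤ (lattice A) := b'.reindex e.symm
  have hrange : (Set.range fun j => intEmb n (c j)) = Set.range fun j => intEmb n (b' j) := by
    have : (fun j => intEmb n (c j)) = (fun j => intEmb n (b' j)) ∘ e := by
      ext j; simp [c]
    rw [this, e.surjective.range_comp]
  rw [← hrange]
  let T : A.direction →ₗ[ℝ] A.direction := (realBasis hA b).constr ℝ (realBasis hA c)
  have hT : ∀ j, T (realBasis hA b j) = realBasis hA c j := fun j =>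
    Module.Basis.constr_basis _ _ _ _
  have himg : ∀ a : Module.Basis ι ℤ (lattice A),
      {u : A.direction | (u : E n) ∈ convexHull ℝ (insert 0 (Set.range fun j => intEmb n (a j)))} =
        convexHull ℝ (insert 0 (Set.range (realBasis hA a))) := by
    intro a
    have h1 : A.direction.subtype '' (insert 0 (Set.range (realBasis hA a))) =
        insert 0 (Set.range fun j => intEmb n (a j)) := by
      rw [Set.image_insert_eq, ← Set.range_comp, map_zero]
      congr 2
      ext1 j
      exact realBasis_apply hA a j
    rw [← h1, ← LinearMap.image_convexHull]
    ext u
    simp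
  have hTimg : T '' convexHull ℝ (insert 0 (Set.range (realBasis hA b))) =
      convexHull ℝ (insert 0 (Set.range (realBasis hA c))) := by
    rw [LinearMap.image_convexHull, Set.image_insert_eq, ← Set.range_comp, map_zero]
    congr 3
    ext1 j
    exact hT j
  -- The change of basis matrix is invertible over `ℤ`, so its determinant is `1` or `-1`.
  have hdet : |LinearMap.det T| = 1 := by
    have hm : LinearMap.toMatrix (realBasis hA b) (realBasis hA b) T =
        (b.toMatrix c).map (Int.castRingHom ℝ) := by
      ext i j
      rw [LinearMap.toMatrix_apply, hT, Matrix.map_apply, Module.Basis.toMatrix_apply]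
      have hc : realBasis hA c j = ∑ i, ((b.repr (c j) i : ℤ) : ℝ) • realBasis hA b i := by
        apply Subtype.ext
        rw [realBasis_apply]
        conv_lhs => rw [← b.sum_repr (c j)]
        simp only [Submodule.coe_sum, map_sum, map_smul, Int.cast_smul_eq_zsmul,
          AddSubgroupClass.coe_zsmul, realBasis_apply]
      rw [hc, Module.Basis.repr_sum_self]
      rfl
    have hu : IsUnit (b.toMatrix c).det := by
      rw [← Module.Basis.det_apply]; exact b.isUnit_det c
    rw [← LinearMap.det_toMatrix (realBasis hA b), hm, ← RingHom.mapMatrix_apply, ← RingHom.map_det]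
    rcases Int.isUnit_iff.1 hu with h | h <;> simp [h]
  rw [himg, himg, ← hTimg, Measure.addHaar_image_linearMap, hdet]
  simp

/-- Translation invariance frees the definition from its chosen base point. -/
theorem volOn_eq {A : AffineSubspace ℝ (E n)} {a : E n} (ha : a ∈ A) (X : Set (E n)) :
    volOn A X = (volume : Measure A.direction).real {u | (u : E n) + a ∈ X} /
      (volume : Measure A.direction).real {u | (u : E n) ∈ unimodularSimplex A} := by
  have h : (A : Set (E n)).Nonempty := ⟨a, ha⟩
  rw [volOn, dif_pos h]
  congr 1
  let t : A.direction := ⟨h.some - a, AffineSubspace.vsub_mem_direction h.some_mem ha⟩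
  have : {u : A.direction | (u : E n) + h.some ∈ X} =
      (fun u => u + t) ⁻¹' {u : A.direction | (u : E n) + a ∈ X} := by
    ext u
    simp [t, add_assoc]
  rw [this, measureReal_def, measureReal_def, measure_preimage_add_right]

theorem affineSpan_insert_eq {A H : AffineSubspace ℝ (E n)} (hle : H ≤ A)
    (hne : (H : Set (E n)).Nonempty)
    (hd : Module.finrank ℝ H.direction + 1 = Module.finrank ℝ A.direction)
    {v : E n} (hv : v ∈ A) (hvH : v ∉ H) : affineSpan ℝ (insert v (H : Set (E n))) = A := by
  set B := affineSpan ℝ (insert v (H : Set (E n)))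
  have hHB : H ≤ B := fun x hx => subset_affineSpan ℝ _ (Set.mem_insert_of_mem _ hx)
  have hvB : v ∈ B := subset_affineSpan ℝ _ (Set.mem_insert _ _)
  have hBA : B ≤ A := affineSpan_le.2 (Set.insert_subset hv hle)
  obtain ⟨p, hp⟩ := hne
  refine AffineSubspace.eq_of_direction_eq_of_nonempty_of_le ?_ ⟨v, hvB⟩ hBA
  refine Submodule.eq_of_le_of_finrank_le (AffineSubspace.direction_le hBA) ?_
  rw [← hd, Nat.add_one_le_iff]
  refine Submodule.finrank_lt_finrank_of_lt (lt_of_le_of_ne (AffineSubspace.direction_le hHB) ?_)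
  intro h
  apply hvH
  have h1 : v -ᵥ p ∈ H.direction := h ▸ AffineSubspace.vsub_mem_direction hvB (hHB hp)
  simpa using AffineSubspace.vadd_mem_of_mem_direction h1 hp

theorem exists_form {V H : Submodule ℝ (E n)} (hle : H ≤ V)
    (hd : Module.finrank ℝ H + 1 = Module.finrank ℝ V) {w : E n} (hw : w ∈ V) (hwH : w ∉ H) :
    ∃ l : E n →ₗ[ℝ] ℝ, l w = 1 ∧ H = V ⊓ LinearMap.ker l := by
  obtain ⟨f, hf, hfH⟩ := Submodule.exists_le_ker_of_notMem hwH
  refine ⟨(f w)⁻¹ • f, by simp [hf], ?_⟩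
  refine Submodule.eq_of_le_of_finrank_le ?_ ?_
  · exact le_inf hle fun x hx => by simp [LinearMap.mem_ker.1 (hfH hx)]
  · rw [← Nat.lt_add_one_iff, hd]
    refine Submodule.finrank_lt_finrank_of_lt (lt_of_le_of_ne inf_le_left fun h => ?_)
    rw [← h] at hw
    have := LinearMap.mem_ker.1 hw.2
    simp [hf] at this

/-- Modulo the lattice of `H`, every vector of the lattice of `A` is a multiple of `w`. A form
vanishing on `H` is thus determined by its value at `w`, and it is primitive exactly when that value
is `1` or `-1`. -/
theorem htOver_eq {A H : AffineSubspace ℝ (E n)} (hle : H ≤ A)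
    (hd : Module.finrank ℝ H.direction + 1 = Module.finrank ℝ A.direction)
    {w : Fin n → ℤ} (hw : w ∈ lattice A) (hwH : intEmb n w ∉ H.direction)
    (hgen : ∀ z ∈ lattice A, ∃ c : ℤ, z + c • w ∈ lattice H)
    {v p : E n} (hv : v ∈ A) (hvH : v ∉ H) (hp : p ∈ H) {h : ℝ} {y : E n}
    (hy : y ∈ H.direction) (hvp : v - p = h • intEmb n w + y) : htOver H v = |h| := by
  have hspan := affineSpan_insert_eq hle ⟨p, hp⟩ hd hv hvH
  have huniq : ∀ t, IsHeight H v t → t = |h| := by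
    rintro t ⟨p', hp', l, hl, hker, rfl⟩
    rw [hspan] at hl hker
    have hl0 : ∀ x ∈ H.direction, l x = 0 := fun x hx => by
      rw [hker] at hx
      exact hx.2
    obtain ⟨m, hm⟩ := hl.1 w hw
    have hmu : IsUnit m := by
      refine hl.2 m fun z hz => ?_
      obtain ⟨c, hc⟩ := hgen z hz
      refine ⟨-c, ?_⟩
      have h1 := hl0 _ hc
      rw [map_add, map_add, map_smul, ← Int.cast_smul_eq_zsmul ℝ, map_smul, hm, smul_eq_mul] at h1
      push_cast
      linarith
    have h2 : v - p' = h • intEmb n w + (y + (p - p')) := by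
      rw [← add_assoc, ← hvp]; abel
    rw [h2, map_add, map_smul, hm,
      hl0 (y + (p - p')) (H.direction.add_mem hy (AffineSubspace.vsub_mem_direction hp hp')), add_zero,
      smul_eq_mul, abs_mul]
    rcases Int.isUnit_iff.1 hmu with rfl | rfl <;> simp
  have hex : ∃ t, IsHeight H v t := by
    obtain ⟨l, hlw, hker⟩ := exists_form (AffineSubspace.direction_le hle) hd hw hwH
    have hval : ∀ z (c : ℤ), z + c • w ∈ lattice H → l (intEmb n z) = -c := by
      intro z c hc
      have h1 : intEmb n (z + c • w) ∈ LinearMap.ker l := by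
        have : intEmb n (z + c • w) ∈ H.direction := hc
        rw [hker] at this
        exact this.2
      rw [LinearMap.mem_ker, map_add, map_add, map_smul, ← Int.cast_smul_eq_zsmul ℝ, map_smul,
        hlw, smul_eq_mul] at h1
      linarith
    refine ⟨_, p, hp, l, ⟨?_, ?_⟩, ?_, rfl⟩
    · rw [hspan]
      intro z hz
      obtain ⟨c, hc⟩ := hgen z hz
      exact ⟨-c, by rw [hval z c hc]; simp⟩
    · rw [hspan]
      intro k hk
      obtain ⟨m, hm⟩ := hk w hw
      rw [hlw] at hm
      exact IsUnit.of_mul_eq_one m (by exact_mod_cast hm.symm)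
    · rw [hspan]
      exact hker
  rw [htOver, if_neg hvH, dif_pos hex]
  exact huniq _ hex.choose_spec

/-- The normalized volume of a pyramid is the product of its height and the normalized volume of
its base. -/
theorem volOn_pyramid {A H : AffineSubspace ℝ (E n)} (hA : IsRationalSubspace A)
    (hH : IsRationalSubspace H) (hle : H ≤ A)
    (hd : Module.finrank ℝ H.direction + 1 = Module.finrank ℝ A.direction)
    {F : Set (E n)} (hFH : F ⊆ H) (hFc : IsCompact F) (hFne : F.Nonempty)
    {v : E n} (hv : v ∈ A) (hvH : v ∉ H) :
    volOn A (convexJoin ℝ {v} F) = htOver H v * volOn H F := by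
  obtain ⟨p, hpF⟩ := hFne
  have hp : p ∈ H := hFH hpF
  have hdir := AffineSubspace.direction_le hle
  obtain ⟨w, hw, hwH, hgen⟩ := exists_complement hA hH hdir hd
  obtain ⟨l, hlw, hker⟩ := exists_form hdir hd hw hwH
  set h := l (v - p) with hh
  have hy : v - p - h • intEmb n w ∈ H.direction := by
    rw [hker]
    refine ⟨Submodule.sub_mem _ (AffineSubspace.vsub_mem_direction hv (hle hp))
      (Submodule.smul_mem _ _ hw), ?_⟩
    rw [SetLike.mem_coe, LinearMap.mem_ker, map_sub, map_smul, hlw, ← hh]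
    simp
  have hvp : v - p = h • intEmb n w + (v - p - h • intEmb n w) := by abel
  have hh0 : h ≠ 0 := by
    intro h0
    rw [h0, zero_smul, sub_zero] at hy
    apply hvH
    rw [← sub_add_cancel v p]
    exact AffineSubspace.vadd_mem_of_mem_direction hy hp
  rw [htOver_eq hle hd hw hwH hgen hv hvH hp hy hvp, volOn_eq (hle hp), volOn_eq hp]
  obtain ⟨c, hc0, hct, hc⟩ := exists_volume_pyramid hdir hd hw hwH
  have hpyr : {u : A.direction | (u : E n) + p ∈ convexJoin ℝ {v} F} =
      {u : A.direction | (u : E n) ∈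
        convexJoin ℝ {h • intEmb n w + (v - p - h • intEmb n w)} ((fun x => x + p) ⁻¹' F)} := by
    ext u
    rw [← hvp, Set.mem_ofPred_eq, Set.mem_ofPred_eq, mem_convexJoin_singleton,
      mem_convexJoin_singleton]
    constructor
    · rintro ⟨r, hr, k, hk, e⟩
      exact ⟨r, hr, k - p, by simpa using hk, by linear_combination (norm := module) e⟩
    · rintro ⟨r, hr, k, hk, e⟩
      exact ⟨r, hr, k + p, hk, by linear_combination (norm := module) e⟩
  have hKc : IsCompact ((fun x => x + p) ⁻¹' F) :=
    (Homeomorph.addRight p).isCompact_preimage.2 hFc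
  have hKH : (fun x => x + p) ⁻¹' F ⊆ H.direction := fun x hx => by
    simpa using AffineSubspace.vsub_mem_direction (hFH hx) hp
  -- The simplex on the completed basis is the pyramid with apex `w` over the simplex of `H`: the
  -- case `h = 1`, `y = 0` of the pyramid formula, with the same constant `c`.
  have hsimp : (volume : Measure A.direction) {u | (u : E n) ∈ unimodularSimplex A} =
      c * (volume : Measure H.direction) {u | (u : E n) ∈ unimodularSimplex H} := by
    set b := Module.finBasis ℤ (lattice H)
    have hli : ∀ c : ℤ, ∀ x ∈ lattice H, c • w + x = 0 → c = 0 := by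
      intro c x hx h0
      by_contra hc0
      apply hwH
      have h1 : (c : ℝ) • intEmb n w = -intEmb n x := by
        rw [Int.cast_smul_eq_zsmul, ← map_smul, ← map_neg, eq_neg_of_add_eq_zero_left h0]
      refine (Submodule.smul_mem_iff H.direction (s := (c : ℝ)) (by exact_mod_cast hc0)).1 ?_
      rw [h1]
      exact Submodule.neg_mem _ hx
    let b' := Module.Basis.mkFinConsOfLE w hw b (lattice_mono hdir) hli hgen
    have hb' : insert 0 (Set.range fun j => intEmb n (b' j)) =
        insert (intEmb n w) (insert 0 (Set.range fun j => intEmb n (b j))) := by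
      rw [Set.insert_comm]
      congr 1
      have : (fun j => intEmb n (b' j)) =
          Fin.cons (intEmb n w) (fun j => intEmb n (b j)) := by
        funext j
        refine Fin.cases ?_ (fun i => ?_) j <;> simp [b']
      rw [this, Fin.range_cons]
    have hbase := hc (convexHull ℝ (insert 0 (Set.range fun j => intEmb n (b j))))
      (convexHull_min (Set.insert_subset (Submodule.zero_mem _)
        (Set.range_subset_iff.2 fun j => (b j).2)) H.direction.convex)
      (((Set.finite_range _).insert 0).isCompact_convexHull (𝕜 := ℝ)) 1 one_ne_zero 0 (Submodule.zero_mem _)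
    rw [one_smul, add_zero, ← convexHull_insert (Set.insert_nonempty _ _), ← hb'] at hbase
    rw [unimodularSimplex, volume_simplex_eq hA _ b', hbase]
    simp [unimodularSimplex, b]
  rw [measureReal_def, measureReal_def, measureReal_def, measureReal_def, hpyr,
    hc _ hKH hKc h hh0 _ hy, hsimp, ENNReal.toReal_mul, ENNReal.toReal_mul, ENNReal.toReal_mul,
    ENNReal.toReal_ofReal (abs_nonneg h)]
  have hc' : c.toReal ≠ 0 := ENNReal.toReal_ne_zero.2 ⟨hc0, hct⟩
  rw [mul_assoc, mul_div_mul_left _ _ hc', mul_div_assoc]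
  rfl

/-! ### Faces of polytopes -/

/-- If a convex combination attains the maximum of `l`, so does every point entering with nonzero
weight. -/
theorem toExposed_convexHull (S : Finset (E n)) (l : StrongDual ℝ (E n)) :
    l.toExposed (convexHull ℝ (S : Set (E n))) =
      convexHull ℝ ((S : Set (E n)) ∩ l.toExposed (convexHull ℝ (S : Set (E n)))) := by
  apply Set.Subset.antisymm
  · intro x hx
    obtain ⟨c, hc0, hc1, hcx⟩ := Finset.mem_convexHull'.1 hx.1
    have hle : ∀ s ∈ S, l s ≤ l x := fun s hs => hx.2 s (subset_convexHull ℝ _ hs)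
    have hsum : ∑ s ∈ S, c s * (l x - l s) = 0 := by
      have : l x = ∑ s ∈ S, c s * l s := by
        conv_lhs => rw [← hcx]
        simp
      simp only [mul_sub, Finset.sum_sub_distrib, ← Finset.sum_mul, hc1, ← this]
      ring
    have hzero := (Finset.sum_eq_zero_iff_of_nonneg fun s hs =>
      mul_nonneg (hc0 s hs) (sub_nonneg.2 (hle s hs))).1 hsum
    have hmem : ∀ s ∈ S, c s ≠ 0 → s ∈ l.toExposed (convexHull ℝ (S : Set (E n))) := by
      intro s hs hcs
      have h1 : l s = l x := by
        rcases mul_eq_zero.1 (hzero s hs) with h | h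
        · exact absurd h hcs
        · linarith
      exact ⟨subset_convexHull ℝ _ hs, fun y hy => by rw [h1]; exact hx.2 y hy⟩
    classical
    rw [← hcx, ← Finset.sum_filter_of_ne (p := fun s => c s ≠ 0)
      (fun s _ h hc => h (by rw [hc, zero_smul]))]
    refine (convex_convexHull ℝ _).sum_mem (fun s hs => hc0 s (Finset.mem_filter.1 hs).1) ?_ ?_
    · rw [Finset.sum_filter_ne_zero, hc1]
    · intro s hs
      obtain ⟨h1, h2⟩ := Finset.mem_filter.1 hs
      exact subset_convexHull ℝ _ ⟨h1, hmem s h1 h2⟩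
  · refine convexHull_min Set.inter_subset_right ?_
    exact (ContinuousLinearMap.toExposed.isExposed (l := l)).convex (convex_convexHull ℝ _)

theorem IsFacet.exists_form {P F : Set (E n)} (h : IsFacet P F) :
    ∃ l : StrongDual ℝ (E n), F = l.toExposed P := h.2.1 h.1

theorem IsFacet.exists_subset {S : Finset (E n)} {F : Set (E n)}
    (h : IsFacet (convexHull ℝ (S : Set (E n))) F) : ∃ T ⊆ S, F = convexHull ℝ (T : Set (E n)) := by
  classical
  obtain ⟨l, rfl⟩ := h.exists_form
  refine ⟨S.filter (· ∈ l.toExposed (convexHull ℝ (S : Set (E n)))), Finset.filter_subset _ _, ?_⟩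
  conv_lhs => rw [toExposed_convexHull]
  congr 1
  ext x
  simp

theorem finite_facets (S : Finset (E n)) :
    {F | IsFacet (convexHull ℝ (S : Set (E n))) F}.Finite := by
  refine (S.powerset.finite_toSet.image
    fun T : Finset (E n) => convexHull ℝ (T : Set (E n))).subset ?_
  intro F hF
  obtain ⟨T, hT, rfl⟩ := hF.exists_subset
  exact ⟨T, by simpa using hT, rfl⟩

theorem IsFacet.subset {P F : Set (E n)} (h : IsFacet P F) : F ⊆ P := h.2.1.subset

theorem affineSpan_toExposed_apply {P : Set (E n)} {l : StrongDual ℝ (E n)} {x y : E n}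
    (hx : x ∈ l.toExposed P) (hy : y ∈ affineSpan ℝ (l.toExposed P)) : l y = l x := by
  refine affineSpan_induction (p := fun z => l z = l x) hy
    (fun z hz => le_antisymm (hx.2 z hz.1) (hz.2 x hx.1)) fun c u v w hu hv hw => ?_
  simp [hu, hv, hw]

/-- The form defining the facet is constant on its affine hull. Hence a facet is determined by its
affine hull. -/
theorem IsFacet.eq_inter {P F : Set (E n)} (h : IsFacet P F) :
    F = P ∩ affineSpan ℝ F := by
  obtain ⟨x, hx⟩ := h.1
  obtain ⟨l, rfl⟩ := h.exists_form
  refine Set.Subset.antisymm (fun y hy => ⟨hy.1, subset_affineSpan ℝ _ hy⟩) ?_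
  rintro y ⟨hyP, hy⟩
  exact ⟨hyP, fun z hz => by rw [affineSpan_toExposed_apply hx hy]; exact hx.2 z hz⟩

/-- Moving `P` into the direction of its affine hull makes it full-dimensional, so that it has
interior points there. -/
theorem affineSpan_preimage_eq_top {P : Set (E n)} {v : E n} (hv : v ∈ P) :
    affineSpan ℝ {u : (affineSpan ℝ P).direction | (u : E n) + v ∈ P} = ⊤ := by
  set V := (affineSpan ℝ P).direction
  let f : V →ᵃ[ℝ] E n := V.subtype.toAffineMap + AffineMap.const ℝ V v
  have hf : ∀ u, f u = u + v := fun u => rfl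
  have himg : f '' {u : V | (u : E n) + v ∈ P} = P := by
    ext x
    constructor
    · rintro ⟨u, hu, rfl⟩
      exact hu
    · intro hx
      refine ⟨⟨x - v, AffineSubspace.vsub_mem_direction (subset_affineSpan ℝ _ hx)
        (subset_affineSpan ℝ _ hv)⟩, ?_, ?_⟩
      · simpa using hx
      · simp [hf]
  rw [eq_top_iff]
  intro u _
  have h1 : f u ∈ affineSpan ℝ P :=
    AffineSubspace.vadd_mem_of_mem_direction u.2 (subset_affineSpan ℝ _ hv)
  rw [← himg, ← AffineSubspace.map_span] at h1
  obtain ⟨u', hu', e⟩ := h1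
  have : u' = u := by
    rw [hf, hf, add_left_inj] at e
    exact Subtype.ext e
  rwa [← this]

/-! ### Covering a polytope by pyramids -/

/-- A point at which a ray issuing from a point of a convex set leaves that set lies on a proper
exposed face. -/
theorem exists_support {P : Set (E n)} (hP : Convex ℝ P) {v y : E n} (hv : v ∈ P) (hy : y ∈ P)
    (hout : ∀ ε > (0 : ℝ), y + ε • (y - v) ∉ P) :
    ∃ l : StrongDual ℝ (E n), y ∈ l.toExposed P ∧ ∃ a ∈ P, l a < l y := by
  set V := (affineSpan ℝ P).direction
  set P' : Set V := {u | (u : E n) + v ∈ P} with hP'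
  have hconv : Convex ℝ P' := by
    intro a ha b hb s t hs ht hst
    have := hP ha hb hs ht hst
    rw [hP', Set.mem_ofPred_eq]
    convert this using 1
    simp only [Submodule.coe_add, Submodule.coe_smul, smul_add]
    rw [add_add_add_comm, ← add_smul, hst, one_smul]
  obtain ⟨a, ha⟩ := hconv.interior_nonempty_iff_affineSpan_eq_top.2
    (affineSpan_preimage_eq_top hv)
  have hmemV : ∀ x ∈ P, x - v ∈ V := fun x hx =>
    AffineSubspace.vsub_mem_direction (subset_affineSpan ℝ _ hx) (subset_affineSpan ℝ _ hv)
  let y' : V := ⟨y - v, hmemV y hy⟩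
  -- At an interior point the ray could be prolonged a little inside `P`.
  have hy' : y' ∉ interior P' := by
    intro h
    have hc : ContinuousAt (fun ε : ℝ => y' + ε • y') 0 := by fun_prop
    have h0 : (fun ε : ℝ => y' + ε • y') 0 = y' := by simp
    have hnhds : interior P' ∈ nhds ((fun ε : ℝ => y' + ε • y') 0) := by
      rw [h0]; exact isOpen_interior.mem_nhds h
    obtain ⟨δ, hδ, hball⟩ := Metric.mem_nhds_iff.1 (hc hnhds)
    have hin : (δ / 2) ∈ Metric.ball (0 : ℝ) δ := by
      rw [Metric.mem_ball, Real.dist_eq, sub_zero, abs_of_pos (half_pos hδ)]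
      exact half_lt_self hδ
    have h2 : y' + (δ / 2) • y' ∈ P' := interior_subset (hball hin)
    refine hout (δ / 2) (half_pos hδ) ?_
    have h3 : ((y' + (δ / 2) • y' : V) : E n) + v ∈ P := h2
    convert h3 using 1
    simp only [Submodule.coe_add, Submodule.coe_smul, y']
    module
  obtain ⟨l', hl'⟩ := geometric_hahn_banach_open_point hconv.interior isOpen_interior hy'
  -- The strict inequality on the interior becomes a weak one on its closure, which contains `P'`.
  have hle : ∀ u ∈ P', l' u ≤ l' y' := by
    intro u hu
    have h1 : u ∈ closure (interior P') := by
      rw [hconv.closure_interior_eq_closure_of_nonempty_interior ⟨a, ha⟩]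
      exact subset_closure hu
    exact closure_minimal (fun z hz => (hl' z hz).le)
      (isClosed_le l'.continuous continuous_const) h1
  -- Orthogonal projection extends the form from `V` to the whole space.
  let l : StrongDual ℝ (E n) := l'.comp V.orthogonalProjectionOnto
  have hl : ∀ u : V, l u = l' u := fun u => by simp [l]
  have hly : l y = l' y' + l v := by
    rw [← hl, ← map_add]; simp [y']
  refine ⟨l, ⟨hy, fun x hx => ?_⟩, (a : E n) + v, (interior_subset ha : a ∈ P'), ?_⟩
  · have h1 := hle ⟨x - v, hmemV x hx⟩ (by simpa [hP'] using hx)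
    have h2 : l x = l' ⟨x - v, hmemV x hx⟩ + l v := by
      rw [← hl, ← map_add]; simp
    linarith
  · rw [map_add, hl, hly]
    linarith [hl' a ha]

theorem volume_affineSubspace_eq_zero {A B : AffineSubspace ℝ (E n)} {a : E n} (ha : a ∈ A)
    (h : ¬ A ≤ B) : (volume : Measure A.direction) {u | (u : E n) + a ∈ B} = 0 := by
  let f : A.direction →ᵃ[ℝ] E n := A.direction.subtype.toAffineMap + AffineMap.const ℝ A.direction a
  refine Measure.addHaar_affineSubspace volume (B.comap f) fun htop => h fun x hx => ?_
  have h1 : (⟨x - a, AffineSubspace.vsub_mem_direction hx ha⟩ : A.direction) ∈ B.comap f := by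
    rw [htop]; trivial
  rw [AffineSubspace.mem_comap] at h1
  simpa [f] using h1

/-- A ray from a point of a compact set leaves it. -/
theorem exists_exit {P : Set (E n)} (hP : IsCompact P) {v x : E n} (hx : x ∈ P) (hxv : x ≠ v) :
    ∃ t : ℝ, 1 ≤ t ∧ v + t • (x - v) ∈ P ∧
      ∀ ε > (0 : ℝ), v + t • (x - v) + ε • (v + t • (x - v) - v) ∉ P := by
  obtain ⟨C, hC⟩ := hP.isBounded.subset_closedBall v
  have hpos : 0 < ‖x - v‖ := norm_pos_iff.2 (sub_ne_zero.2 hxv)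
  set T : Set ℝ := {t | v + t • (x - v) ∈ P} with hT
  have hTb : T ⊆ Metric.closedBall 0 (C / ‖x - v‖) := by
    intro t ht
    have := hC ht
    rw [Metric.mem_closedBall, dist_eq_norm, add_sub_cancel_left, norm_smul] at this
    rw [mem_closedBall_zero_iff, le_div_iff₀ hpos]
    exact this
  have hTc : IsCompact T :=
    Metric.isCompact_of_isClosed_isBounded (hP.isClosed.preimage (by fun_prop))
      (Metric.isBounded_closedBall.subset hTb)
  have h1 : (1 : ℝ) ∈ T := by simpa [hT] using hx
  obtain ⟨t, ht, hmax⟩ := hTc.exists_isGreatest ⟨1, h1⟩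
  refine ⟨t, hmax h1, ht, fun ε hε hmem => ?_⟩
  -- A further point on the ray would have parameter `t + ε * t`, which exceeds the greatest element
  -- `t` since `t ≥ 1`.
  have h2 : t + ε * t ∈ T := by
    rw [hT, Set.mem_ofPred_eq]
    convert hmem using 1
    module
  have := hmax h2
  have h3 := hmax h1
  nlinarith

theorem mem_affineSpan_insert_of_mem_convexJoin {v x : E n} {F : Set (E n)}
    (hx : x ∈ convexJoin ℝ {v} F) : x ∈ affineSpan ℝ (insert v F) := by
  obtain ⟨r, -, k, hk, rfl⟩ := mem_convexJoin_singleton.1 hx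
  have := AffineMap.lineMap_mem r (subset_affineSpan ℝ _ (Set.mem_insert_of_mem v hk))
    (subset_affineSpan ℝ (insert v F) (Set.mem_insert v F))
  rw [AffineMap.lineMap_apply_module] at this
  rwa [add_comm]

theorem finrank_affineSpan_insert_le (F : Set (E n)) (v : E n) :
    Module.finrank ℝ (affineSpan ℝ (insert v F)).direction ≤
      Module.finrank ℝ (affineSpan ℝ F).direction + 1 := by
  rw [direction_affineSpan, direction_affineSpan]
  exact finrank_vectorSpan_insert_le_set ℝ F v

/-- Every point of a polytope lies in a pyramid with apex `v` over a facet or in one of finitely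
many proper affine subspaces. -/
theorem mem_pyramid_or_mem_affineSpan {S : Finset (E n)} {P : Set (E n)}
    (hPS : P = convexHull ℝ (S : Set (E n))) (hdim : 1 ≤ dim P) {v x : E n} (hv : v ∈ P)
    (hx : x ∈ P) :
    (∃ F, IsFacet P F ∧ v ∉ affineSpan ℝ F ∧ x ∈ convexJoin ℝ {v} F) ∨
      ∃ T ⊆ S, ¬ affineSpan ℝ P ≤ affineSpan ℝ (insert v (T : Set (E n))) ∧
        x ∈ affineSpan ℝ (insert v (T : Set (E n))) := by
  classical
  have hPc : IsCompact P := by rw [hPS]; exact S.finite_toSet.isCompact_convexHull ℝ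
  have hPconv : Convex ℝ P := by rw [hPS]; exact convex_convexHull ℝ _
  by_cases hxv : x = v
  · refine Or.inr ⟨∅, Finset.empty_subset _, fun h => ?_, ?_⟩
    · have h1 := Submodule.finrank_mono (AffineSubspace.direction_le h)
      have h2 : Module.finrank ℝ (affineSpan ℝ (insert v ((∅ : Finset (E n)) : Set (E n)))).direction
          = 0 := by simp [direction_affineSpan]
      rw [h2] at h1
      change 1 ≤ Module.finrank ℝ (affineSpan ℝ P).direction at hdim
      omega
    · rw [hxv]
      exact subset_affineSpan ℝ _ (Set.mem_insert _ _)
  obtain ⟨t, ht1, hyP, hout⟩ := exists_exit hPc hx hxv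
  obtain ⟨l, hyG, a, ha, hal⟩ := exists_support hPconv hv hyP hout
  set y := v + t • (x - v) with hy
  set G := l.toExposed P with hG
  have hxG : x ∈ convexJoin ℝ {v} G := by
    have ht0 : t ≠ 0 := by linarith
    refine mem_convexJoin_singleton.2 ⟨1 - t⁻¹, ⟨?_, ?_⟩, y, hyG, ?_⟩
    · linarith [inv_le_one_of_one_le₀ ht1]
    · have : 0 ≤ t⁻¹ := inv_nonneg.2 (by linarith)
      linarith
    · rw [hy, sub_sub_cancel, smul_add, inv_smul_smul₀ ht0]
      module
  have hGT : G = convexHull ℝ ((S.filter (· ∈ G) : Finset (E n)) : Set (E n)) := by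
    have h1 := toExposed_convexHull S l
    rw [← hPS, ← hG] at h1
    conv_lhs => rw [h1]
    congr 1
    ext z
    simp
  have hspan : affineSpan ℝ (insert v G) =
      affineSpan ℝ (insert v ((S.filter (· ∈ G) : Finset (E n)) : Set (E n))) := by
    rw [← Set.singleton_union, ← Set.singleton_union, AffineSubspace.span_union,
      AffineSubspace.span_union]
    conv_lhs => rw [hGT, affineSpan_convexHull]
  have hxB := mem_affineSpan_insert_of_mem_convexJoin hxG
  -- If `G` and `v` do not span the hull of `P`, the vertex set of `G` within `S` gives an
  -- exceptional subspace. Otherwise `G` has codimension at most 1, and at least 1 because `l` is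
  -- not constant on `P`; so `G` is a facet.
  by_cases hAB : affineSpan ℝ P ≤ affineSpan ℝ (insert v G)
  swap
  · exact Or.inr ⟨S.filter (· ∈ G), Finset.filter_subset _ _, hspan ▸ hAB, hspan ▸ hxB⟩
  left
  have hGP : G ⊆ P := fun z hz => hz.1
  have hnot : ¬ affineSpan ℝ P ≤ affineSpan ℝ G := by
    intro h
    exact hal.ne (affineSpan_toExposed_apply hyG (h (subset_affineSpan ℝ _ ha)))
  have hlt : affineSpan ℝ G < affineSpan ℝ P :=
    lt_of_le_not_ge (affineSpan_mono ℝ hGP) hnot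
  refine ⟨G, ⟨⟨y, hyG⟩, ContinuousLinearMap.toExposed.isExposed, ?_⟩, fun hvG => hnot ?_, hxG⟩
  · have h1 := (Submodule.finrank_mono (AffineSubspace.direction_le hAB)).trans
      (finrank_affineSpan_insert_le G v)
    have h2 := Submodule.finrank_lt_finrank_of_lt (AffineSubspace.direction_lt_of_nonempty hlt
      ⟨y, subset_affineSpan ℝ _ hyG⟩)
    change Module.finrank ℝ (affineSpan ℝ G).direction + 1 =
      Module.finrank ℝ (affineSpan ℝ P).direction
    omega
  · exact hAB.trans (affineSpan_le.2 (Set.insert_subset hvG (subset_affineSpan ℝ _)))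

/-! ### Overlaps of pyramids and the decomposition of the volume -/

theorem IsFacet.apply_lt {P F : Set (E n)} {l : StrongDual ℝ (E n)} (hl : F = l.toExposed P)
    {v f : E n} (hv : v ∈ P) (hvF : v ∉ affineSpan ℝ F) (hf : f ∈ F) : l v < l f := by
  subst hl
  refine lt_of_le_of_ne (hf.2 v hv) fun h => hvF (subset_affineSpan ℝ _ ⟨hv, fun z hz => ?_⟩)
  rw [h]
  exact hf.2 z hz

/-- Seen from `v`, no point of `P` lies beyond `F` in the same direction: the form defining `F`
increases from `v` to `f` and is at most `l f` at `g`. -/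
theorem weight_le {P F : Set (E n)} (hF : IsFacet P F) {v f g : E n} (hv : v ∈ P)
    (hvF : v ∉ affineSpan ℝ F) (hf : f ∈ F) (hg : g ∈ P) {r s : ℝ} (hs : 0 ≤ s)
    (h : r • (f - v) = s • (g - v)) : r ≤ s := by
  obtain ⟨l, hl⟩ := hF.exists_form
  have h1 := IsFacet.apply_lt hl hv hvF hf
  have h2 : l g ≤ l f := by
    rw [hl] at hf
    exact hf.2 g hg
  have h3 := congrArg l h
  rw [map_smul, map_smul, map_sub, map_sub, smul_eq_mul, smul_eq_mul] at h3
  by_contra! hrs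
  nlinarith [mul_lt_mul_of_pos_right hrs (sub_pos.2 h1), mul_nonneg hs (sub_nonneg.2 h2)]

theorem mem_affineSpan_of_mem_pyramids {P F G : Set (E n)} (hF : IsFacet P F) (hG : IsFacet P G)
    {v x : E n} (hv : v ∈ P) (hvF : v ∉ affineSpan ℝ F) (hvG : v ∉ affineSpan ℝ G)
    (hxF : x ∈ convexJoin ℝ {v} F) (hxG : x ∈ convexJoin ℝ {v} G) :
    x ∈ affineSpan ℝ (insert v (F ∩ G)) := by
  by_cases hxv : x = v
  · rw [hxv]
    exact subset_affineSpan ℝ _ (Set.mem_insert _ _)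
  obtain ⟨r, hr, f, hf, e₁⟩ := mem_convexJoin_singleton.1 hxF
  obtain ⟨s, hs, g, hg, e₂⟩ := mem_convexJoin_singleton.1 hxG
  have h1 : (1 - r) • (f - v) = (1 - s) • (g - v) := by
    linear_combination (norm := module) e₂ - e₁
  -- Neither base point lies beyond the other on the ray from `v`, so the two coincide and lie in `F
  -- ∩ G`.
  have hrs : 1 - r = 1 - s := le_antisymm
    (weight_le hF hv hvF hf (hG.subset hg) (sub_nonneg.2 hs.2) h1)
    (weight_le hG hv hvG hg (hF.subset hf) (sub_nonneg.2 hr.2) h1.symm)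
  have hne : 1 - s ≠ 0 := by
    intro h0
    apply hxv
    have : s = 1 := by linarith
    rw [e₂, this]
    simp
  rw [hrs] at h1
  have hfg : f = g := by simpa using smul_right_injective _ hne h1
  subst hfg
  exact mem_affineSpan_insert_of_mem_convexJoin
    (mem_convexJoin_singleton.2 ⟨r, hr, f, ⟨hf, hg⟩, e₁⟩)

theorem not_le_affineSpan_insert_inter {P F G : Set (E n)} (hdim : 1 ≤ dim P) (hF : IsFacet P F)
    (hG : IsFacet P G) (hFG : F ≠ G) (v : E n) :
    ¬ affineSpan ℝ P ≤ affineSpan ℝ (insert v (F ∩ G)) := by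
  intro h
  have h0 := Submodule.finrank_mono (AffineSubspace.direction_le h)
  have h1 := h0.trans (finrank_affineSpan_insert_le (F ∩ G) v)
  have hFd := hF.2.2
  have hGd := hG.2.2
  simp only [dim] at hdim hFd hGd
  -- The empty set has `dim` equal to 0, so the bound `h1` gives no contradiction when `dim P = 1`;
  -- the empty case uses `h0` instead. In the nonempty case, `F` and `G` would share the affine hull
  -- of `F ∩ G` and be equal.
  rcases (F ∩ G).eq_empty_or_nonempty with he | hne
  · rw [he] at h0
    have h2 : Module.finrank ℝ (affineSpan ℝ (insert v (∅ : Set (E n)))).direction = 0 := by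
      simp [direction_affineSpan]
    omega
  · have key : ∀ X : Set (E n), F ∩ G ⊆ X →
        Module.finrank ℝ (affineSpan ℝ X).direction ≤
          Module.finrank ℝ (affineSpan ℝ (F ∩ G)).direction →
        affineSpan ℝ (F ∩ G) = affineSpan ℝ X := fun X hX hle =>
      AffineSubspace.eq_of_direction_eq_of_nonempty_of_le
        (Submodule.eq_of_le_of_finrank_le
          (AffineSubspace.direction_le (affineSpan_mono ℝ hX)) hle)
        (hne.mono (subset_affineSpan ℝ _)) (affineSpan_mono ℝ hX)
    apply hFG
    rw [hF.eq_inter, hG.eq_inter, ← key F Set.inter_subset_left (by omega),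
      ← key G Set.inter_subset_right (by omega)]

/-- A polytope is, up to null sets, the disjoint union of the pyramids with apex `v` over the facets
whose affine hull does not contain `v`. -/
theorem volOn_eq_sum_pyramids {S : Finset (E n)} {P : Set (E n)}
    (hPS : P = convexHull ℝ (S : Set (E n))) (hdim : 1 ≤ dim P) {v : E n} (hv : v ∈ P)
    (t : Finset (Set (E n))) (ht : ∀ F, F ∈ t ↔ IsFacet P F ∧ v ∉ affineSpan ℝ F) :
    volOn (affineSpan ℝ P) P = ∑ F ∈ t, volOn (affineSpan ℝ P) (convexJoin ℝ {v} F) := by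
  set A := affineSpan ℝ P with hA
  have hvA : v ∈ A := subset_affineSpan ℝ _ hv
  let f : A.direction → E n := fun u => u + v
  have hf : Continuous f := by fun_prop
  have hPconv : Convex ℝ P := by rw [hPS]; exact convex_convexHull ℝ _
  have hpyrc : ∀ F ∈ t, IsCompact (convexJoin ℝ {v} F) := by
    intro F hF
    have hF' := ((ht F).1 hF).1
    rw [hPS] at hF'
    obtain ⟨T, -, rfl⟩ := hF'.exists_subset
    exact isCompact_convexJoin_singleton _ (T.finite_toSet.isCompact_convexHull ℝ)
  have hfe : Topology.IsClosedEmbedding f :=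
    (Homeomorph.addRight v).isClosedEmbedding.comp
      A.direction.closed_of_finiteDimensional.isClosedEmbedding_subtypeVal
  have hpre : ∀ X : Set (E n), IsCompact X → (volume : Measure A.direction) (f ⁻¹' X) ≠ ∞ :=
    fun X hX => (hfe.isCompact_preimage hX).measure_lt_top.ne
  have hsub : (⋃ F ∈ t, f ⁻¹' convexJoin ℝ {v} F) ⊆ f ⁻¹' P := by
    refine Set.iUnion₂_subset fun F hF u hu => ?_
    obtain ⟨r, hr, k, hk, e⟩ := mem_convexJoin_singleton.1 hu
    rw [Set.mem_preimage, e]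
    exact hPconv hv (((ht F).1 hF).1.subset hk) hr.1 (by linarith [hr.2]) (by ring)
  -- Subsets of the finite set `S` index the exceptional subspaces, so there are finitely many, each
  -- of measure zero.
  have hdiff : (volume : Measure A.direction) (f ⁻¹' P \ ⋃ F ∈ t, f ⁻¹' convexJoin ℝ {v} F) = 0 := by
    classical
    refine measure_mono_null (t := ⋃ T ∈ S.powerset.filter
      (fun T : Finset (E n) => ¬ A ≤ affineSpan ℝ (insert v (T : Set (E n)))),
        f ⁻¹' (affineSpan ℝ (insert v (T : Set (E n))) : Set (E n))) ?_ ?_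
    · rintro u ⟨huP, hu⟩
      rcases mem_pyramid_or_mem_affineSpan hPS hdim hv huP with ⟨F, hF, hvF, hmem⟩ | ⟨T, hT, h1, h2⟩
      · exact absurd (Set.mem_iUnion₂.2 ⟨F, (ht F).2 ⟨hF, hvF⟩, hmem⟩) hu
      · exact Set.mem_iUnion₂.2 ⟨T, Finset.mem_filter.2 ⟨Finset.mem_powerset.2 hT, h1⟩, h2⟩
    · refine (measure_biUnion_null_iff (Finset.countable_toSet _)).2 fun T hT => ?_
      exact volume_affineSubspace_eq_zero hvA (Finset.mem_filter.1 hT).2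
  have hmeas : (volume : Measure A.direction).real (f ⁻¹' P) =
      ∑ F ∈ t, (volume : Measure A.direction).real (f ⁻¹' convexJoin ℝ {v} F) := by
    rw [← measureReal_biUnion_finset₀ (s := t) (f := fun F => f ⁻¹' convexJoin ℝ {v} F)
      (h := fun F hF => hpre _ (hpyrc F hF))]
    · rw [measureReal_def, measureReal_def]
      congr 1
      refine le_antisymm ?_ (measure_mono hsub)
      rw [← Set.sdiff_union_of_subset hsub]
      refine (measure_union_le _ _).trans ?_
      rw [hdiff, zero_add]
    -- The pyramids are disjoint only almost everywhere: each overlap lies in a proper affine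
    -- subspace.
    · intro F hF G hG hFG
      obtain ⟨hF1, hF2⟩ := (ht F).1 hF
      obtain ⟨hG1, hG2⟩ := (ht G).1 hG
      refine measure_mono_null ?_ (volume_affineSubspace_eq_zero hvA
        (not_le_affineSpan_insert_inter hdim hF1 hG1 hFG v))
      rintro u ⟨h1, h2⟩
      exact mem_affineSpan_of_mem_pyramids hF1 hG1 hv hF2 hG2 h1 h2
    · exact fun F hF => ((hpyrc F hF).isClosed.preimage hf).measurableSet.nullMeasurableSet
  simp_rw [volOn_eq hvA]
  rw [← Finset.sum_div]
  exact congrArg (· / _) hmeas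

end LatticeGeometry

end

theorem proposition5 {n : ℕ} (P : Set (LatticeGeometry.E n))
    (hP : LatticeGeometry.IsRationalPolytope P) (hdim : 1 ≤ LatticeGeometry.dim P)
    (v : LatticeGeometry.E n) (hv : v ∈ P) :
    {F : Set (LatticeGeometry.E n) | LatticeGeometry.IsFacet P F}.Finite ∧
    LatticeGeometry.Vol P =
      ∑ᶠ F ∈ {F : Set (LatticeGeometry.E n) | LatticeGeometry.IsFacet P F},
        LatticeGeometry.Ht F v * LatticeGeometry.Vol F := by
  classical
  have hrat := hP.isRationalSubspace
  obtain ⟨S, hS, hPS⟩ := hP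
  have hfin : {F : Set (LatticeGeometry.E n) | LatticeGeometry.IsFacet P F}.Finite := by
    rw [hPS]
    exact LatticeGeometry.finite_facets S
  refine ⟨hfin, ?_⟩
  rw [finsum_mem_eq_finite_toFinset_sum _ hfin, LatticeGeometry.Vol,
    LatticeGeometry.volOn_eq_sum_pyramids hPS hdim hv
      (hfin.toFinset.filter fun F => v ∉ affineSpan ℝ F) (by simp), Finset.sum_filter]
  refine Finset.sum_congr rfl fun F hF => ?_
  have hFf : LatticeGeometry.IsFacet P F := by simpa using hF
  by_cases hvF : v ∈ affineSpan ℝ F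
  · rw [if_neg (not_not.2 hvF), LatticeGeometry.Ht, LatticeGeometry.htOver, if_pos hvF, zero_mul]
  · rw [if_pos hvF]
    -- The facet is spanned by points of `S`, hence is a rational polytope, and the pyramid formula
    -- applies to its affine hull.
    obtain ⟨T, hTS, hFT⟩ := LatticeGeometry.IsFacet.exists_subset (hPS ▸ hFf)
    have hFrat : LatticeGeometry.IsRationalPolytope F := ⟨T, fun x hx => hS x (hTS hx), hFT⟩
    exact LatticeGeometry.volOn_pyramid hrat hFrat.isRationalSubspace
      (affineSpan_mono ℝ hFf.subset) hFf.2.2 (subset_affineSpan ℝ F)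
      (by rw [hFT]; exact T.finite_toSet.isCompact_convexHull ℝ) hFf.1
      (subset_affineSpan ℝ P hv) hvF
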